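/- Let $r,p\ge 1$ and $m\ge p+r$ be integers, let $a_{-r},\dots,a_p\in\mathbb{C}$ with $a_{-r}\neq 0$ and $a_p\neq 0$, and let $B=(b_{j,k})_{-r\le j\le -1,\,0\le k\le m-1}$ be a complex $r\times m$ matrix. Consider the scheme $U_j^{n+1}=\sum_{k=-r}^{p}a_kU_{j+k}^n$ ($j\ge 0$) with the boundary condition $U_j^n=\sum_{k=0}^{m-1}b_{j,k}U_k^n+g_j^n$ ($-r\le j\le -1$), where $(g_j^n)$ are given boundary data. Eliminating the ghost values $U_{-r}^n,\dots,U_{-1}^n$ when $g=0$ gives $(U_0^{n+1},\dots,U_{r-1}^{n+1})^T=\mathcal{B}\,(U_0^n,\dots,U_{m-1}^n)^T$, where $\mathcal{B}=TB+A\in\mathcal{M}_{r,m}(\mathbb{C})$ has, for indices starting at $0$, $T_{i,l}=a_{-r+l-i}$ if $i\le l\le r-1$ and $T_{i,l}=0$ if $l<i$, and $A_{i,k}=a_{k-i}$ if $k\le i+p$ and $A_{i,k}=0$ otherwise. Assume that the scheme is Cauchy-stable: $\left|\sum_{k=-r}^{p}a_ke^{ik\xi}\right|\le 1$ for all $\xi\in\mathbb{R}$.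 For $|z|>1$, let the stable roots at $z$ be the roots $\kappa$, counted with multiplicity, of the characteristic equation $z\kappa^r=\sum_{k=-r}^{p}a_k\kappa^{r+k}$ with $|\kappa|<1$. For $|z|=1$, let the stable roots at $z$ be the limit, as a multiset, of the stable roots at $w$ as $w\to z$ with $|w|>1$ (the roots that come from inside the disk). For $|z|\ge 1$ let $\kappa_1,\dots,\kappa_M$ be the distinct stable roots at $z$, with multiplicities $\mu_1,\dots,\mu_M$ in this multiset, and for $n\ge 1$ let $K_{0,n-1}(z)$ be the matrix with rows $j=0,\dots,n-1$ whose columns are $(j^{\sigma}\kappa_\ell^{\,j})_{0\le j\le n-1}$ for $1\le\ell\le M$ and $0\le\sigma<\mu_\ell$ (with $0^0=1$), in any order, the same for all $n$. The intrinsic Kreiss-Lopatinskii determinant is $$\Delta(z)=\frac{\det\left(zK_{0,r-1}(z)-\mathcal{B}K_{0,m-1}(z)\right)}{\det K_{0,r-1}(z)},\qquad |z|\ge 1.$$ Then $\Delta$ is well defined on $\{|z|\ge 1\}$: for $|z|=1$ the limit multiset exists and is unique, for $|z|\ge 1$ there are exactly $r$ stable roots counted with multiplicity, $\det K_{0,r-1}(z)\ne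 0$, and the quotient does not depend on the order of the columns. Moreover, $\Delta$ is holomorphic on $\{z\in\mathbb{C}:|z|>1\}$ and continuous on $\{z\in\mathbb{C}:|z|\ge 1\}$. -/

import Mathlib

open Polynomial Filter Topology

namespace KreissLopatinskii

noncomputable section

/-- The symbol `γ(ξ) = ∑_{k=-r}^{p} a_k e^{ikξ}` of the scheme
`U_j^{n+1} = ∑_{k=-r}^{p} a_k U_{j+k}^n`. Only the values `a k` with `-r ≤ k ≤ p` matter. -/
def symbol (r p : ℕ) (a : ℤ → ℂ) (ξ : ℝ) : ℂ :=
  ∑ k ∈ Finset.Icc (-(r : ℤ)) (p : ℤ), a k * Complex.exp (Complex.I * (k : ℂ) * (ξ : ℂ))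

/-- Cauchy-stability: `|γ(ξ)| ≤ 1` for all real `ξ`. -/
def CauchyStable (r p : ℕ) (a : ℤ → ℂ) : Prop :=
  ∀ ξ : ℝ, ‖symbol r p a ξ‖ ≤ 1

/-- The polynomial `P_z(κ) = ∑_{k=-r}^{p} a_k κ^{r+k} - z κ^r` of the characteristic equation;
the summation index is `l = r + k`. -/
def charPoly (r p : ℕ) (a : ℤ → ℂ) (z : ℂ) : ℂ[X] :=
  (∑ l ∈ Finset.range (r + p + 1), C (a ((l : ℤ) - (r : ℤ))) * X ^ l) - C z * X ^ r

open Classical in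
/-- The roots of the characteristic equation in the open unit disk, with multiplicity. -/
def insideRoots (r p : ℕ) (a : ℤ → ℂ) (z : ℂ) : Multiset ℂ :=
  (charPoly r p a z).roots.filter (fun κ => ‖κ‖ < 1)

/-- `s` is the limit, as a multiset, of the roots lying in the open unit disk for the parameter
`w` when `w → z` with `|w| > 1`: for every `ε > 0` and every such `w` close enough to `z`, the
roots for `w` can be matched one-to-one with the elements of `s` at distance less than `ε`.
For `|z| = 1` these are the roots for `z` that come from inside the disk. -/
def ComesFromInside (r p : ℕ) (a : ℤ → ℂ) (z : ℂ) (s : Multiset ℂ) : Prop :=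
  ∀ ε : ℝ, 0 < ε → ∀ᶠ w in 𝓝[{w : ℂ | 1 < ‖w‖}] z,
    Multiset.Rel (fun κ κ' : ℂ => ‖κ - κ'‖ < ε) (insideRoots r p a w) s

open Classical in
/-- The stable roots, with multiplicity: for `|z| > 1` the roots in the open unit disk, and for
`|z| = 1` the roots that come from inside the disk. -/
def stableRoots (r p : ℕ) (a : ℤ → ℂ) (z : ℂ) : Multiset ℂ :=
  if 1 < ‖z‖ then insideRoots r p a z
  else if h : ∃ s, ComesFromInside r p a z s then h.choose else 0

/-- The matrix `K_{0,n-1}` attached to a multiset of roots. Its columns are indexed by the pairs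
`(κ, σ)` with `0 ≤ σ < multiplicity of κ`, and the column `(κ, σ)` is `(j^σ κ^j)_{0 ≤ j ≤ n-1}`
(with `0^0 = 1`). -/
def kMatrix (n : ℕ) (s : Multiset ℂ) : Matrix (Fin n) s.ToType ℂ :=
  Matrix.of fun j c => ((j : ℕ) : ℂ) ^ (c.2 : ℕ) * c.1 ^ (j : ℕ)

/-- `K_{0,n-1}(z)` with its `r` columns listed in the order `e`. -/
def kMat (r p : ℕ) (a : ℤ → ℂ) (z : ℂ) (e : Fin r ≃ (stableRoots r p a z).ToType) (n : ℕ) :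
    Matrix (Fin n) (Fin r) ℂ :=
  (kMatrix n (stableRoots r p a z)).submatrix id e

/-- The matrix `𝓑` obtained by eliminating the ghost values
`U_j = ∑_{k=0}^{m-1} b_{j,k} U_k`, `-r ≤ j ≤ -1`, from the scheme at the points `0, …, r-1`.
The row `l` of `b` holds the coefficients `b_{-r+l,k}`. -/
def boundaryMatrix (r p m : ℕ) (a : ℤ → ℂ) (b : Matrix (Fin r) (Fin m) ℂ) :
    Matrix (Fin r) (Fin m) ℂ :=
  (Matrix.of fun i l : Fin r =>
      if (i : ℕ) ≤ (l : ℕ) then a (-(r : ℤ) + ((l : ℕ) : ℤ) - ((i : ℕ) : ℤ)) else 0) * b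
    + Matrix.of fun (i : Fin r) (k : Fin m) =>
      if (k : ℕ) ≤ (i : ℕ) + p then a (((k : ℕ) : ℤ) - ((i : ℕ) : ℤ)) else 0

/-- The Kreiss-Lopatinskii determinant `det (z K_{0,r-1}(z) - 𝓑 K_{0,m-1}(z))`, for the order `e`
of the columns. -/
def klDet (r p m : ℕ) (a : ℤ → ℂ) (b : Matrix (Fin r) (Fin m) ℂ) (z : ℂ)
    (e : Fin r ≃ (stableRoots r p a z).ToType) : ℂ :=
  (z • kMat r p a z e r - boundaryMatrix r p m a b * kMat r p a z e m).det

open Classical in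
/-- The intrinsic Kreiss-Lopatinskii determinant
`Δ(z) = det (z K_{0,r-1}(z) - 𝓑 K_{0,m-1}(z)) / det K_{0,r-1}(z)`, computed with any order of the
columns. -/
def intrinsicDet (r p m : ℕ) (a : ℤ → ℂ) (b : Matrix (Fin r) (Fin m) ℂ) (z : ℂ) : ℂ :=
  if h : Nonempty (Fin r ≃ (stableRoots r p a z).ToType) then
    klDet r p m a b z h.some / (kMat r p a z h.some r).det
  else 0

end

end KreissLopatinskii

/-!
Let `Q` be the monic polynomial whose roots are the stable roots at `z`, and `R` the matrix of the
reduction of polynomials modulo `Q`. A polynomial is divisible by `Q` exactly when its coefficient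
vector is orthogonal to the columns of `K`; this makes `K_{0,r-1}` invertible and gives
`K_{0,m-1} = R K_{0,r-1}`, so `Δ(z) = det (z - 𝓑 R)` is a polynomial in `z` and the coefficients of
`Q`. For `|z| > 1` these coefficients are holomorphic: the power sums of the stable roots are
contour integrals over the unit circle, where Cauchy-stability leaves no root, and Newton's
identities express the coefficients through them.

At a boundary point any limit of `Q` divides the characteristic polynomial, so there are finitely
many possible limits. Small half-neighborhoods of the point are connected, so `Q` cannot oscillate
between two of them and converges.
-/

namespace KreissLopatinskii

noncomputable section

/-! ### Polynomials with prescribed roots and the matrices `K` -/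

section RootPoly

variable {R : Type*} [CommRing R]

/-- The monic polynomial `∏ (X - κ)` over the elements `κ` of the multiset `s`. -/
def rootPoly (s : Multiset R) : R[X] := (s.map fun κ => X - C κ).prod

lemma monic_rootPoly (s : Multiset R) : (rootPoly s).Monic :=
  monic_multisetProd_X_sub_C s

variable [IsDomain R]

lemma natDegree_rootPoly (s : Multiset R) : (rootPoly s).natDegree = s.card :=
  natDegree_multiset_prod_X_sub_C_eq_card s

lemma degree_rootPoly (s : Multiset R) : (rootPoly s).degree = s.card := by
  rw [degree_eq_natDegree (monic_rootPoly s).ne_zero, natDegree_rootPoly]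

lemma rootPoly_injective : Function.Injective (rootPoly : Multiset R → R[X]) :=
  Function.LeftInverse.injective (g := roots) roots_multiset_prod_X_sub_C

lemma rootPoly_dvd_iff_le_roots {P : R[X]} (hP : P ≠ 0) (s : Multiset R) :
    rootPoly s ∣ P ↔ s ≤ P.roots :=
  Multiset.prod_X_sub_C_dvd_iff_le_roots hP s

lemma rootPoly_dvd_iff_forall_pow_dvd [DecidableEq R] (s : Multiset R) (P : R[X]) :
    rootPoly s ∣ P ↔ ∀ κ, (X - C κ) ^ s.count κ ∣ P := by
  by_cases hP : P = 0
  · simp [hP]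
  · simp only [rootPoly_dvd_iff_le_roots hP, Multiset.le_iff_count, count_roots,
      le_rootMultiplicity_iff hP]

end RootPoly

section Euler

variable {K : Type*} [Field K]

/-- The Euler operator `P ↦ X P'`, whose iterates detect the multiplicity of the nonzero roots. -/
def euler : Module.End K K[X] := LinearMap.mulLeft K X ∘ₗ derivative

lemma euler_apply (P : K[X]) : euler P = X * derivative P := rfl

lemma coeff_euler_pow (σ : ℕ) (P : K[X]) (j : ℕ) :
    ((euler ^ σ) P).coeff j = (j : K) ^ σ * P.coeff j := by
  induction σ generalizing P with
  | zero => simp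
  | succ σ ih =>
    have hstep : (euler P).coeff j = j * P.coeff j := by
      cases j <;> simp [euler_apply, coeff_derivative, mul_comm]
    rw [pow_succ, Module.End.mul_apply, ih, hstep, pow_succ, mul_assoc]

lemma euler_pow_X_pow (σ j : ℕ) : (euler ^ σ) (X ^ j : K[X]) = C ((j : K) ^ σ) * X ^ j := by
  ext i
  rw [coeff_euler_pow, coeff_C_mul, coeff_X_pow]
  split_ifs with h <;> simp [h]

lemma eval_euler_pow {n : ℕ} {P : K[X]} (hP : P.degree < n) (σ : ℕ) (κ : K) :
    ((euler ^ σ) P).eval κ = ∑ j : Fin n, P.coeff j * ((j : K) ^ σ * κ ^ (j : ℕ)) := by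
  have hdeg : ((euler ^ σ) P).degree < n := by
    rw [degree_lt_iff_coeff_zero] at hP ⊢
    exact fun j hj => by rw [coeff_euler_pow, hP j hj, mul_zero]
  rw [eval_eq_sum, ← sum_fin (fun j c => c * κ ^ j) (by simp) hdeg]
  exact Finset.sum_congr rfl fun j _ => by rw [coeff_euler_pow]; ring

lemma X_sub_C_pow_dvd_euler_iff {κ : K} (hκ : κ ≠ 0) (n : ℕ) (P : K[X]) :
    (X - C κ) ^ n ∣ euler P ↔ (X - C κ) ^ n ∣ derivative P := by
  have hcop : IsCoprime (X - C κ) X := by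
    simpa using isCoprime_X_sub_C_of_isUnit_sub (a := κ) (b := 0) (by simpa using hκ)
  exact ⟨hcop.pow_left.dvd_of_dvd_mul_left, fun h => h.mul_left _⟩

variable [CharZero K]

lemma X_sub_C_pow_succ_dvd_iff {κ : K} (n : ℕ) (P : K[X]) :
    (X - C κ) ^ (n + 1) ∣ P ↔ P.eval κ = 0 ∧ (X - C κ) ^ n ∣ derivative P := by
  by_cases hroot : P.IsRoot κ
  · simp only [show P.eval κ = 0 from hroot, true_and]
    by_cases hconst : derivative P = 0
    · rw [derivative_eq_zero] at hconst
      rw [eq_C_of_natDegree_eq_zero hconst, IsRoot.def, eval_C] at hroot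
      rw [eq_C_of_natDegree_eq_zero hconst, hroot]
      simp
    · have hP : P ≠ 0 := fun h => hconst (by rw [h, derivative_zero])
      have hpos := (rootMultiplicity_pos hP).2 hroot
      rw [← le_rootMultiplicity_iff hP, ← le_rootMultiplicity_iff hconst,
        derivative_rootMultiplicity_of_root hroot]
      omega
  · simp only [show ¬ P.eval κ = 0 from hroot, false_and, iff_false]
    exact fun h => hroot (dvd_iff_isRoot.1 ((dvd_pow_self _ n.succ_ne_zero).trans h))

lemma X_sub_C_pow_dvd_iff {κ : K} (hκ : κ ≠ 0) (n : ℕ) (P : K[X]) :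
    (X - C κ) ^ n ∣ P ↔ ∀ σ < n, ((euler ^ σ) P).eval κ = 0 := by
  induction n generalizing P with
  | zero => simp
  | succ n ih =>
    rw [X_sub_C_pow_succ_dvd_iff, ← X_sub_C_pow_dvd_euler_iff hκ, ih, Nat.forall_lt_succ_left]
    simp only [pow_zero, Module.End.one_apply, pow_succ, Module.End.mul_apply]

lemma rootPoly_dvd_iff_eval_euler_pow [DecidableEq K] {s : Multiset K} (hs : (0 : K) ∉ s)
    (P : K[X]) :
    rootPoly s ∣ P ↔ ∀ c : s.ToType, ((euler ^ (c.2 : ℕ)) P).eval c.1 = 0 := by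
  have hne : ∀ κ ∈ s, κ ≠ 0 := fun κ hκ h => hs (h ▸ hκ)
  rw [rootPoly_dvd_iff_forall_pow_dvd]
  constructor
  · intro h c
    have hc : c.1 ∈ s := Multiset.count_pos.1 (Nat.zero_lt_of_lt c.2.2)
    exact (X_sub_C_pow_dvd_iff (hne _ hc) _ _).1 (h c.1) _ c.2.2
  · intro h κ
    by_cases hκ : κ ∈ s
    · exact (X_sub_C_pow_dvd_iff (hne κ hκ) _ _).2 fun σ hσ => h ⟨κ, σ, hσ⟩
    · simp [Multiset.count_eq_zero_of_notMem hκ]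

end Euler

section KMatrix

variable {r : ℕ} {s : Multiset ℂ}

lemma vecMul_kMatrix {n : ℕ} {P : ℂ[X]} (hP : P.degree < n) :
    Matrix.vecMul (fun j : Fin n => P.coeff j) (kMatrix n s)
      = fun c => ((euler ^ (c.2 : ℕ)) P).eval c.1 := by
  ext c
  rw [eval_euler_pow hP]
  rfl

lemma card_eq_of_equiv_toType (e : Fin r ≃ s.ToType) : s.card = r := by
  rw [← Multiset.card_coe s, ← Fintype.card_congr e, Fintype.card_fin]

lemma det_kMatrix_ne_zero (hs : (0 : ℂ) ∉ s) (e : Fin r ≃ s.ToType) :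
    ((kMatrix r s).submatrix id e).det ≠ 0 := by
  intro hdet
  obtain ⟨v, hv, hker⟩ := Matrix.exists_vecMul_eq_zero_iff.2 hdet
  have hdeg : (ofFn r v).degree < r := ofFn_degree_lt v
  have hcoeff : (fun j : Fin r => (ofFn r v).coeff j) = v :=
    funext fun j => ofFn_coeff_eq_val_of_lt v j.2
  have hdvd : rootPoly s ∣ ofFn r v := by
    refine (rootPoly_dvd_iff_eval_euler_pow hs _).2 fun c => ?_
    have hc : Matrix.vecMul v (kMatrix r s) c = 0 := by
      simpa [Matrix.vecMul, dotProduct] using congrFun hker (e.symm c)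
    rwa [← hcoeff, vecMul_kMatrix hdeg] at hc
  have hzero : ofFn r v = 0 := eq_zero_of_dvd_of_degree_lt hdvd <| by
    rwa [degree_rootPoly, card_eq_of_equiv_toType e]
  exact hv (by rw [← hcoeff, hzero]; rfl)

/-- The matrix whose row `j` holds the coefficients of the remainder of `X ^ j` modulo `Q`. When
`Q` is monic of degree `r` it is the matrix of the reduction modulo `Q`, from polynomials of degree
`< n` to polynomials of degree `< r`. -/
def remainderMatrix {R : Type*} [CommRing R] (n r : ℕ) (Q : R[X]) : Matrix (Fin n) (Fin r) R :=
  Matrix.of fun j i => (X ^ (j : ℕ) %ₘ Q).coeff i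

lemma kMatrix_eq_remainderMatrix_mul (hs : (0 : ℂ) ∉ s) (n : ℕ) :
    kMatrix n s = remainderMatrix n s.card (rootPoly s) * kMatrix s.card s := by
  ext j c
  have hdeg : (X ^ (j : ℕ) %ₘ rootPoly s).degree < s.card :=
    (degree_modByMonic_lt _ (monic_rootPoly s)).trans_eq (degree_rootPoly s)
  have hdvd : rootPoly s ∣ X ^ (j : ℕ) - X ^ (j : ℕ) %ₘ rootPoly s :=
    ⟨_, sub_eq_of_eq_add' (modByMonic_add_div _ _).symm⟩
  have heval := (rootPoly_dvd_iff_eval_euler_pow hs _).1 hdvd c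
  rw [map_sub, eval_sub, sub_eq_zero, euler_pow_X_pow] at heval
  calc kMatrix n s j c = ((euler ^ (c.2 : ℕ)) (X ^ (j : ℕ) %ₘ rootPoly s)).eval c.1 := by
        rw [← heval]; simp [kMatrix]
    _ = _ := (congrFun (vecMul_kMatrix hdeg) c).symm

lemma det_sub_kMatrix_div_det {m : ℕ} (hs : (0 : ℂ) ∉ s) (e : Fin r ≃ s.ToType)
    (M : Matrix (Fin r) (Fin m) ℂ) (z : ℂ) :
    (z • (kMatrix r s).submatrix id e - M * (kMatrix m s).submatrix id e).det
        / ((kMatrix r s).submatrix id e).det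
      = (M * remainderMatrix m r (rootPoly s)).charpoly.eval z := by
  obtain rfl := card_eq_of_equiv_toType e
  have hmul : (kMatrix m s).submatrix id e
      = remainderMatrix m s.card (rootPoly s) * (kMatrix s.card s).submatrix id e := by
    conv_lhs => rw [kMatrix_eq_remainderMatrix_mul hs]
    rw [← Matrix.submatrix_mul_equiv _ _ id (Equiv.refl _) e]
    rfl
  rw [div_eq_iff (det_kMatrix_ne_zero hs e), hmul, Matrix.eval_charpoly, ← Matrix.det_mul,
    Matrix.sub_mul, ← Matrix.mul_assoc, Matrix.scalar_apply, Matrix.smul_eq_diagonal_mul]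

end KMatrix

section RemainderMatrix

lemma map_freeMonic_eval_coeff {R : Type*} [CommRing R] {r : ℕ} {Q : R[X]} (hQ : Q.Monic)
    (hdeg : Q.natDegree = r) :
    (freeMonic R r).map (MvPolynomial.eval fun i : Fin r => Q.coeff i) = Q := by
  ext j
  rw [coeff_map, coeff_freeMonic]
  split_ifs with hlt heq
  · simp
  · simp [heq, ← hdeg, hQ]
  · rw [map_zero, coeff_eq_zero_of_natDegree_lt (by omega)]

lemma remainderMatrix_map {R S : Type*} [CommRing R] [CommRing S] (f : R →+* S) (n r : ℕ)
    {Q : R[X]} (hQ : Q.Monic) :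
    remainderMatrix n r (Q.map f) = (remainderMatrix n r Q).map f := by
  ext j i
  simp [remainderMatrix, ← coeff_map, map_modByMonic _ hQ]

/-- The value at `z` of the characteristic polynomial of `M * R`, where `R` is the matrix of the
reduction modulo `X ^ r + ∑ i, q i X ^ i`. The quotient defining `Δ(z)` is of this form; here the
dependence on the coefficients `q` is visibly polynomial. -/
def reducedDet {r m : ℕ} (M : Matrix (Fin r) (Fin m) ℂ) (z : ℂ) (q : Fin r → ℂ) : ℂ :=
  (M * (remainderMatrix m r (freeMonic ℂ r)).map (MvPolynomial.eval q)).charpoly.eval z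

lemma reducedDet_coeff {r m : ℕ} (M : Matrix (Fin r) (Fin m) ℂ) (z : ℂ) {Q : ℂ[X]} (hQ : Q.Monic)
    (hdeg : Q.natDegree = r) :
    reducedDet M z (fun i => Q.coeff i) = (M * remainderMatrix m r Q).charpoly.eval z := by
  rw [reducedDet, ← remainderMatrix_map _ _ _ (monic_freeMonic _ _),
    map_freeMonic_eval_coeff hQ hdeg]

lemma differentiable_eval_mvPolynomial {ι : Type*} [Finite ι] (f : MvPolynomial ι ℂ) :
    Differentiable ℂ fun q : ι → ℂ => MvPolynomial.eval q f := by
  have := Fintype.ofFinite ι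
  exact fun q => (AnalyticOnNhd.eval_mvPolynomial f q (Set.mem_univ q)).differentiableAt

lemma differentiable_det {𝕜 E ι : Type*} [NontriviallyNormedField 𝕜] [NormedAddCommGroup E]
    [NormedSpace 𝕜 E] [Fintype ι] [DecidableEq ι] {A : E → Matrix ι ι 𝕜}
    (hA : ∀ i j, Differentiable 𝕜 fun x => A x i j) : Differentiable 𝕜 fun x => (A x).det := by
  simp only [Matrix.det_apply']
  refine Differentiable.fun_sum fun σ _ => Differentiable.const_mul ?_ _
  exact fun x =>
    (HasFDerivAt.finsetProd fun i _ => (hA (σ i) i x).hasFDerivAt).differentiableAt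

lemma differentiable_reducedDet {r m : ℕ} (M : Matrix (Fin r) (Fin m) ℂ) :
    Differentiable ℂ fun x : ℂ × (Fin r → ℂ) => reducedDet M x.1 x.2 := by
  have hentry (f : MvPolynomial (Fin r) ℂ) :
      Differentiable ℂ fun x : ℂ × (Fin r → ℂ) => MvPolynomial.eval x.2 f :=
    (differentiable_eval_mvPolynomial f).fun_comp differentiable_snd
  simp only [reducedDet, Matrix.eval_charpoly]
  refine differentiable_det fun i j => ?_
  simp only [Matrix.sub_apply, Matrix.mul_apply, Matrix.map_apply, Matrix.scalar_apply,
    Matrix.diagonal_apply]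
  refine Differentiable.sub ?_ (Differentiable.fun_sum fun k _ => (hentry _).const_mul _)
  split_ifs <;> fun_prop

end RemainderMatrix

/-! ### The argument principle for holomorphic families of polynomials -/

section ParametricIntegral

open MeasureTheory Metric

lemma aestronglyMeasurable_deriv_of_mem_nhds {𝕜 α E : Type*} [NontriviallyNormedField 𝕜]
    [NormedAddCommGroup E] [NormedSpace 𝕜 E] {_ : MeasurableSpace α} {μ : Measure α}
    {f : 𝕜 → α → E} {U : Set 𝕜} {u₀ : 𝕜} (hU : U ∈ 𝓝 u₀)
    (hmeas : ∀ u ∈ U, AEStronglyMeasurable (f u) μ)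
    (hdiff : ∀ᵐ x ∂μ, DifferentiableAt 𝕜 (fun u => f u x) u₀) :
    AEStronglyMeasurable (fun x => deriv (fun u => f u x) u₀) μ := by
  refine aestronglyMeasurable_of_tendsto_ae (𝓝[≠] u₀)
    (f := U.indicator fun u x => slope (fun v => f v x) u₀ u) (fun u => ?_) ?_
  · by_cases hu : u ∈ U
    · simp only [Set.indicator_of_mem hu, slope_def_module]
      exact ((hmeas u hu).sub (hmeas u₀ (mem_of_mem_nhds hU))).const_smul _
    · rw [Set.indicator_of_notMem hu]
      exact aestronglyMeasurable_zero
  · filter_upwards [hdiff] with x hx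
    refine (hasDerivAt_iff_tendsto_slope.1 hx.hasDerivAt).congr' ?_
    filter_upwards [mem_nhdsWithin_of_mem_nhds hU] with u hu
    rw [Set.indicator_of_mem hu]

lemma differentiableOn_setIntegral {α E : Type*} [TopologicalSpace α] [MeasurableSpace α]
    [OpensMeasurableSpace α] [NormedAddCommGroup E] [NormedSpace ℂ E]
    {μ : Measure α} [IsFiniteMeasureOnCompacts μ] {K : Set α} (hK : IsCompact K)
    (hKm : MeasurableSet K) {U : Set ℂ} (hU : IsOpen U) {f : ℂ → α → E}
    (hcont : ContinuousOn (Function.uncurry f) (U ×ˢ K))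
    (hdiff : ∀ x ∈ K, DifferentiableOn ℂ (fun u => f u x) U) :
    DifferentiableOn ℂ (fun u => ∫ x in K, f u x ∂μ) U := by
  intro u₀ hu₀
  have hslice : ∀ u ∈ U, ContinuousOn (f u) K := fun u hu =>
    hcont.comp (f := fun x => (u, x)) (by fun_prop) fun x hx => ⟨hu, hx⟩
  have hmeas : ∀ u ∈ U, AEStronglyMeasurable (f u) (μ.restrict K) := fun u hu =>
    (hslice u hu).aestronglyMeasurable_of_isCompact hK hKm
  obtain ⟨δ, hδ, hball⟩ := nhds_basis_closedBall.mem_iff.1 (hU.mem_nhds hu₀)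
  obtain ⟨M, hM⟩ := ((isCompact_closedBall u₀ δ).prod hK).exists_bound_of_continuousOn
    (hcont.mono (Set.prod_mono_left hball))
  have hderiv_bound : ∀ x ∈ K, ∀ u ∈ ball u₀ (δ / 2), ‖deriv (fun v => f v x) u‖ ≤ M / (δ / 2) := by
    intro x hx u hu
    have hsub : closedBall u (δ / 2) ⊆ closedBall u₀ δ :=
      closedBall_subset_closedBall' (by linarith [mem_ball.1 hu])
    refine Complex.norm_deriv_le_of_forall_mem_sphere_norm_le (half_pos hδ) ?_ fun v hv =>
      hM (v, x) ⟨hsub (sphere_subset_closedBall hv), hx⟩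
    exact ((hdiff x hx).mono (closure_ball_subset_closedBall.trans (hsub.trans hball))).diffContOnCl
  have hdiffAt : ∀ x ∈ K, ∀ u ∈ U, DifferentiableAt ℂ (fun v => f v x) u := fun x hx u hu =>
    (hdiff x hx).differentiableAt (hU.mem_nhds hu)
  have hfin : IsFiniteMeasure (μ.restrict K) := ⟨by simpa using hK.measure_lt_top⟩
  refine (hasDerivAt_integral_of_dominated_loc_of_deriv_le (bound := fun _ => M / (δ / 2))
    (F' := fun u x => deriv (fun v => f v x) u)
    (ball_mem_nhds u₀ (half_pos hδ)) ?_ ((hslice u₀ hu₀).integrableOn_compact' hK hKm)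
    (aestronglyMeasurable_deriv_of_mem_nhds (hU.mem_nhds hu₀) hmeas ?_) ?_ (integrable_const _)
    ?_).2.differentiableAt.differentiableWithinAt
  · filter_upwards [hU.mem_nhds hu₀] with u hu using hmeas u hu
  all_goals refine (ae_restrict_iff' hKm).2 (.of_forall fun x hx => ?_)
  · exact hdiffAt x hx u₀ hu₀
  · exact hderiv_bound x hx
  · exact fun u hu => (hdiffAt x hx u (hball (ball_subset_closedBall
      (ball_subset_ball (half_le_self hδ.le) hu)))).hasDerivAt

lemma differentiableOn_circleIntegral {E : Type*} [NormedAddCommGroup E] [NormedSpace ℂ E]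
    {U : Set ℂ} (hU : IsOpen U) {c : ℂ} {R : ℝ} (hR : 0 ≤ R) {f : ℂ → ℂ → E}
    (hcont : ContinuousOn (Function.uncurry f) (U ×ˢ sphere c R))
    (hdiff : ∀ x ∈ sphere c R, DifferentiableOn ℂ (fun u => f u x) U) :
    DifferentiableOn ℂ (fun u => ∮ x in C(c, R), f u x) U := by
  have hmem (θ : ℝ) : circleMap c R θ ∈ sphere c R := circleMap_mem_sphere c hR θ
  simp only [circleIntegral_def_Icc, deriv_circleMap]
  refine differentiableOn_setIntegral isCompact_Icc measurableSet_Icc hU ?_ fun θ _ =>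
    (hdiff _ (hmem θ)).const_smul _
  refine ContinuousOn.smul (by fun_prop) ?_
  exact hcont.comp (f := fun x : ℂ × ℝ => (x.1, circleMap c R x.2)) (by fun_prop)
    fun x hx => ⟨hx.1, hmem x.2⟩

end ParametricIntegral

section ArgumentPrinciple

open Metric

variable {c : ℂ} {R : ℝ}

open Classical in
/-- The roots of `P` in the open disk of center `c` and radius `R`, with multiplicity. -/
def rootsInBall (P : ℂ[X]) (c : ℂ) (R : ℝ) : Multiset ℂ := P.roots.filter (· ∈ ball c R)

open Classical in
lemma mem_ball_of_mem_rootsInBall {P : ℂ[X]} {κ : ℂ} (h : κ ∈ rootsInBall P c R) : κ ∈ ball c R :=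
  (Multiset.mem_filter.1 h).2

open Classical in
lemma rootsInBall_le_roots (P : ℂ[X]) : rootsInBall P c R ≤ P.roots := Multiset.filter_le _ _

open Classical in
lemma circleIntegral_mul_inv_sub (hR : 0 < R) {g : ℂ → ℂ} (hg : DiffContOnCl ℂ g (ball c R))
    {w : ℂ} (hw : w ∉ sphere c R) :
    (∮ x in C(c, R), g x * (x - w)⁻¹)
      = if w ∈ ball c R then 2 * Real.pi * Complex.I * g w else 0 := by
  split_ifs with h
  · simpa [mul_comm] using hg.circleIntegral_sub_inv_smul h
  · have hne : ∀ x ∈ closure (ball c R), x - w ≠ 0 := by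
      rw [closure_ball c hR.ne']
      rintro x hx hxw
      rw [sub_eq_zero] at hxw
      exact (ball_union_sphere (x := c) (ε := R) ▸ hxw ▸ hx).elim h hw
    have hinv : DiffContOnCl ℂ (fun x => (x - w)⁻¹) (ball c R) :=
      (differentiable_id.sub_const w).diffContOnCl.inv hne
    exact (hg.smul hinv).circleIntegral_eq_zero hR.le

lemma circleIntegrable_mul_inv_sub (hR : 0 < R) {g : ℂ → ℂ} (hg : DiffContOnCl ℂ g (ball c R))
    {w : ℂ} (hw : w ∉ sphere c R) : CircleIntegrable (fun x => g x * (x - w)⁻¹) c R := by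
  refine (ContinuousOn.mul ?_ ?_).circleIntegrable hR.le
  · exact hg.continuousOn_ball.mono sphere_subset_closedBall
  · exact ContinuousOn.inv₀ (by fun_prop) fun x hx => sub_ne_zero.2 fun h => hw (h ▸ hx)

lemma circleIntegral_multiset_sum {ι E : Type*} [NormedAddCommGroup E] [NormedSpace ℂ E]
    (s : Multiset ι) {f : ι → ℂ → E} (hf : ∀ i ∈ s, CircleIntegrable (f i) c R) :
    (∮ x in C(c, R), (s.map fun i => f i x).sum) = (s.map fun i => ∮ x in C(c, R), f i x).sum := by
  classical
  simp only [← Multiset.map_univ s, ← Finset.sum_eq_multiset_sum]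
  exact circleIntegral.integral_fun_sum fun i _ => hf i Multiset.coe_mem

lemma multiset_sum_filter {ι M : Type*} [AddCommMonoid M] (p : ι → Prop) [DecidablePred p]
    (s : Multiset ι) (f : ι → M) :
    ((s.filter p).map f).sum = (s.map fun i => if p i then f i else 0).sum := by
  induction s using Multiset.induction with
  | empty => simp
  | cons i s ih => by_cases hi : p i <;> simp [hi, ih]

theorem sum_map_rootsInBall (hR : 0 < R) {g : ℂ → ℂ} (hg : DiffContOnCl ℂ g (ball c R))
    {P : ℂ[X]} (hP : ∀ x ∈ sphere c R, P.eval x ≠ 0) :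
    ((rootsInBall P c R).map g).sum = (2 * Real.pi * Complex.I)⁻¹ *
      ∮ x in C(c, R), g x * ((derivative P).eval x / P.eval x) := by
  classical
  have hs : ∀ w ∈ P.roots, w ∉ sphere c R := fun w hw h => hP w h (isRoot_of_mem_roots hw)
  have hlog : ∀ x ∈ sphere c R, g x * ((derivative P).eval x / P.eval x)
      = (P.roots.map fun w => g x * (x - w)⁻¹).sum := fun x hx => by
    rw [(IsAlgClosed.splits P).eval_derivative_div_eval_of_ne_zero (hP x hx),
      ← Multiset.sum_map_mul_left]
    simp only [one_div]
  rw [circleIntegral.integral_congr hR.le hlog, circleIntegral_multiset_sum _ fun w hw =>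
      circleIntegrable_mul_inv_sub hR hg (hs w hw),
    Multiset.map_congr rfl fun w hw => circleIntegral_mul_inv_sub hR hg (hs w hw),
    rootsInBall, multiset_sum_filter, ← Multiset.sum_map_mul_left]
  refine congrArg Multiset.sum (Multiset.map_congr rfl fun w _ => ?_)
  rw [mul_ite, mul_zero, inv_mul_cancel_left₀ Complex.two_pi_I_ne_zero]

end ArgumentPrinciple

section HolomorphicFamily

open Metric

lemma mul_esymm_eq_sum_pow {R : Type*} [CommRing R] (s : Multiset R) (k : ℕ) :
    (k : R) * s.esymm k = (-1) ^ (k + 1) *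
      ∑ c ∈ Finset.HasAntidiagonal.antidiagonal k with c.1 < k,
        (-1) ^ c.1 * s.esymm c.1 * (s.map fun κ => κ ^ c.2).sum := by
  classical
  have hpsum (l : ℕ) : ∑ i : s, (i : R) ^ l = (s.map fun κ => κ ^ l).sum := by
    rw [Finset.sum_eq_multiset_sum, Multiset.map_univ s fun κ => κ ^ l]
  have h := congrArg (MvPolynomial.aeval (R := R) fun i : s => (i : R))
    (MvPolynomial.mul_esymm_eq_sum s R k)
  simpa only [map_mul, map_natCast, map_pow, map_neg, map_one, map_sum, MvPolynomial.psum, hpsum,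
    MvPolynomial.aeval_esymm_eq_multiset_esymm, MvPolynomial.aeval_X, Multiset.map_univ_coe] using h

lemma differentiableOn_esymm {U : Set ℂ} {s : ℂ → Multiset ℂ}
    (hs : ∀ k, DifferentiableOn ℂ (fun u => ((s u).map fun κ => κ ^ k).sum) U) (k : ℕ) :
    DifferentiableOn ℂ (fun u => (s u).esymm k) U := by
  induction k using Nat.strong_induction_on with
  | _ k ih =>
    rcases eq_or_ne k 0 with rfl | hk
    · simp [Multiset.esymm]
    · have hnewton (u : ℂ) : (s u).esymm k = (k : ℂ)⁻¹ * ((-1) ^ (k + 1) *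
          ∑ c ∈ Finset.HasAntidiagonal.antidiagonal k with c.1 < k,
            (-1) ^ c.1 * (s u).esymm c.1 * ((s u).map fun κ => κ ^ c.2).sum) := by
        rw [← mul_esymm_eq_sum_pow, inv_mul_cancel_left₀ (Nat.cast_ne_zero.2 hk)]
      simp only [hnewton]
      refine ((DifferentiableOn.fun_sum fun c hc => ?_).const_mul _).const_mul _
      exact ((ih c.1 (Finset.mem_filter.1 hc).2).const_mul _).mul (hs c.2)

/-- A family of polynomials of degree `< N` whose coefficients are holomorphic on `U` as functions
of the parameter. -/
structure HolomorphicFamily (P : ℂ → ℂ[X]) (N : ℕ) (U : Set ℂ) : Prop where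
  differentiableOn_coeff : ∀ i, DifferentiableOn ℂ (fun u => (P u).coeff i) U
  natDegree_lt : ∀ u ∈ U, (P u).natDegree < N

namespace HolomorphicFamily

variable {P : ℂ → ℂ[X]} {N : ℕ} {U : Set ℂ}

protected lemma derivative (hP : HolomorphicFamily P N U) :
    HolomorphicFamily (fun u => derivative (P u)) N U where
  differentiableOn_coeff i := by
    simpa only [coeff_derivative] using (hP.differentiableOn_coeff (i + 1)).mul_const _
  natDegree_lt u hu :=
    ((natDegree_derivative_le _).trans (Nat.sub_le _ 1)).trans_lt (hP.natDegree_lt u hu)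

lemma differentiableOn_eval (hP : HolomorphicFamily P N U) (x : ℂ) :
    DifferentiableOn ℂ (fun u => (P u).eval x) U := by
  refine DifferentiableOn.congr ?_ fun u hu => eval_eq_sum_range' (hP.natDegree_lt u hu) x
  exact DifferentiableOn.fun_sum fun i _ => (hP.differentiableOn_coeff i).mul_const _

lemma continuousOn_eval (hP : HolomorphicFamily P N U) (S : Set ℂ) :
    ContinuousOn (fun y : ℂ × ℂ => (P y.1).eval y.2) (U ×ˢ S) := by
  refine ContinuousOn.congr ?_ fun y hy => eval_eq_sum_range' (hP.natDegree_lt y.1 hy.1) y.2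
  refine continuousOn_finsetSum _ fun i _ => ContinuousOn.mul ?_ (by fun_prop)
  exact (hP.differentiableOn_coeff i).continuousOn.comp continuousOn_fst fun y hy => hy.1

variable {c : ℂ} {R : ℝ}

lemma differentiableOn_sum_map_rootsInBall (hP : HolomorphicFamily P N U) (hU : IsOpen U)
    (hR : 0 < R) (hne : ∀ u ∈ U, ∀ x ∈ sphere c R, (P u).eval x ≠ 0) {g : ℂ → ℂ}
    (hg : DiffContOnCl ℂ g (ball c R)) :
    DifferentiableOn ℂ (fun u => ((rootsInBall (P u) c R).map g).sum) U := by
  refine DifferentiableOn.congr ?_ fun u hu => sum_map_rootsInBall hR hg (hne u hu)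
  refine (differentiableOn_circleIntegral hU hR.le ?_ fun x hx => ?_).const_mul _
  · refine ContinuousOn.mul ?_ ((hP.derivative.continuousOn_eval _).div (hP.continuousOn_eval _)
      fun y hy => hne y.1 hy.1 y.2 hy.2)
    exact (hg.continuousOn_ball.mono sphere_subset_closedBall).comp continuousOn_snd
      fun y hy => hy.2
  · exact ((hP.derivative.differentiableOn_eval x).div (hP.differentiableOn_eval x)
      fun u hu => hne u hu x hx).const_mul _

lemma card_rootsInBall_eq (hP : HolomorphicFamily P N U) (hU : IsOpen U) (hpre : IsPreconnected U)
    (hR : 0 < R) (hne : ∀ u ∈ U, ∀ x ∈ sphere c R, (P u).eval x ≠ 0) {u v : ℂ} (hu : u ∈ U)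
    (hv : v ∈ U) : (rootsInBall (P u) c R).card = (rootsInBall (P v) c R).card := by
  have hcast : ContinuousOn (fun u => ((rootsInBall (P u) c R).card : ℂ)) U := by
    simpa using (hP.differentiableOn_sum_map_rootsInBall hU hR hne
      (diffContOnCl_const (c := (1 : ℂ)))).continuousOn
  refine hpre.constant (f := fun u => (rootsInBall (P u) c R).card) ?_ hu hv
  rw [Nat.isClosedEmbedding_coe_real.isEmbedding.continuousOn_iff]
  exact Complex.continuous_re.comp_continuousOn hcast

theorem differentiableOn_coeff_rootPoly (hP : HolomorphicFamily P N U) (hU : IsOpen U)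
    (hpre : IsPreconnected U) (hR : 0 < R) (hne : ∀ u ∈ U, ∀ x ∈ sphere c R, (P u).eval x ≠ 0)
    (i : ℕ) : DifferentiableOn ℂ (fun u => (rootPoly (rootsInBall (P u) c R)).coeff i) U := by
  rcases U.eq_empty_or_nonempty with rfl | ⟨v, hv⟩
  · exact differentiableOn_empty
  have hcard : ∀ u ∈ U, (rootsInBall (P u) c R).card = (rootsInBall (P v) c R).card := fun u hu =>
    hP.card_rootsInBall_eq hU hpre hR hne hu hv
  rcases le_or_gt i (rootsInBall (P v) c R).card with hi | hi
  · refine ((differentiableOn_esymm (fun k => ?_) _).const_mul _).congr fun u hu => by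
      rw [rootPoly, Multiset.prod_X_sub_C_coeff _ (hi.trans_eq (hcard u hu).symm), hcard u hu]
    exact hP.differentiableOn_sum_map_rootsInBall hU hR hne
      (differentiable_id.pow k).diffContOnCl
  · refine (differentiableOn_const 0).congr fun u hu => ?_
    exact coeff_eq_zero_of_natDegree_lt (by rwa [natDegree_rootPoly, hcard u hu])

end HolomorphicFamily

end HolomorphicFamily

/-! ### Limits of multisets of roots -/

section FiniteLimitSet

variable {X Y ι : Type*} [TopologicalSpace X] [TopologicalSpace Y] {F : Filter X} {p : ι → Prop}
  {W : ι → Set X} {f : X → Y}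

lemma tendsto_nhdsSet_or_of_isPreconnected (hF : F.HasBasis p W)
    (hpre : ∀ i, p i → IsPreconnected (W i)) (hf : ∀ i, p i → ContinuousOn f (W i)) {A B : Set Y}
    (hAB : SeparatedNhds A B) (hlim : Tendsto f F (𝓝ˢ A ⊔ 𝓝ˢ B)) :
    Tendsto f F (𝓝ˢ A) ∨ Tendsto f F (𝓝ˢ B) := by
  obtain ⟨V, V', hV, hV', hA, hB, hdisj⟩ := hAB
  have hVA : V ∈ 𝓝ˢ A := hV.mem_nhdsSet.2 hA
  have hVB : V' ∈ 𝓝ˢ B := hV'.mem_nhdsSet.2 hB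
  have hsup {N N' : Set Y} (hN : N ∈ 𝓝ˢ A) (hN' : N' ∈ 𝓝ˢ B) : ∀ᶠ x in F, f x ∈ N ∪ N' :=
    hlim (union_mem_sup hN hN')
  obtain ⟨i, hi, hW⟩ := hF.mem_iff.1 (hsup hVA hVB)
  have hWF : ∀ᶠ x in F, f x ∈ f '' W i :=
    mem_of_superset (hF.mem_of_mem hi) (Set.subset_preimage_image f _)
  refine (((hpre i hi).image f (hf i hi)).subset_or_subset hV hV' hdisj
    (Set.image_subset_iff.2 hW)).imp (fun hsub N hN => ?_) fun hsub N hN => ?_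
  · filter_upwards [hWF, hsup hN hVB] with x hx hxN
    exact hxN.resolve_right (Set.disjoint_left.1 hdisj (hsub hx))
  · filter_upwards [hWF, hsup hVA hN] with x hx hxN
    exact hxN.resolve_left (Set.disjoint_right.1 hdisj (hsub hx))

lemma exists_tendsto_of_tendsto_nhdsSet_finite [T2Space Y] [NeBot F] (hF : F.HasBasis p W)
    (hpre : ∀ i, p i → IsPreconnected (W i)) (hf : ∀ i, p i → ContinuousOn f (W i)) {S : Set Y}
    (hS : S.Finite) (hlim : Tendsto f F (𝓝ˢ S)) : ∃ y ∈ S, Tendsto f F (𝓝 y) := by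
  induction S, hS using Set.Finite.induction_on with
  | empty => simp [NeBot.ne ‹_›] at hlim
  | @insert y S hy hS ih =>
    rw [Set.insert_eq, nhdsSet_union] at hlim
    have hsep : SeparatedNhds {y} S :=
      .of_isCompact_isCompact isCompact_singleton hS.isCompact (Set.disjoint_singleton_left.2 hy)
    rcases tendsto_nhdsSet_or_of_isPreconnected hF hpre hf hsep hlim with h | h
    · exact ⟨y, Set.mem_insert y S, by rwa [nhdsSet_singleton] at h⟩
    · obtain ⟨y', hy', h'⟩ := ih h
      exact ⟨y', Set.mem_insert_of_mem y hy', h'⟩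

end FiniteLimitSet

section RootwiseTendsto

variable {α E : Type*} [NormedAddCommGroup E] {F : Filter α}

/-- Convergence of multisets: for every `ε > 0`, eventually the elements of `s x` can be matched
one-to-one with those of `t` at distance less than `ε`. -/
def RootwiseTendsto (s : α → Multiset E) (F : Filter α) (t : Multiset E) : Prop :=
  ∀ ε : ℝ, 0 < ε → ∀ᶠ x in F, Multiset.Rel (fun κ κ' => ‖κ - κ'‖ < ε) (s x) t

lemma RootwiseTendsto.congr' {s s' : α → Multiset E} {t : Multiset E}
    (h : RootwiseTendsto s F t) (hss : s =ᶠ[F] s') : RootwiseTendsto s' F t := fun ε hε => by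
  filter_upwards [h ε hε, hss] with x hx heq using heq ▸ hx

lemma rootwiseTendsto_univ_map {ι : Type*} [Fintype ι] {v : α → ι → E} {y : ι → E}
    (hv : Tendsto v F (𝓝 y)) :
    RootwiseTendsto (fun x => Finset.univ.val.map (v x)) F (Finset.univ.val.map y) := by
  intro ε hε
  filter_upwards [hv.eventually (Metric.ball_mem_nhds y hε)] with x hx
  refine Multiset.rel_map.2 (Multiset.rel_refl_of_refl_on fun i _ => ?_)
  rw [← dist_eq_norm]
  exact (dist_le_pi_dist (v x) y i).trans_lt hx

lemma multiset_rel_trans {β γ δ : Type*} {p : β → γ → Prop} {q : γ → δ → Prop} {p' : β → δ → Prop}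
    (h : ∀ a b c, p a b → q b c → p' a c) {u : Multiset β} {s : Multiset γ} {t : Multiset δ}
    (hs : Multiset.Rel p u s) (ht : Multiset.Rel q s t) : Multiset.Rel p' u t := by
  induction hs generalizing t with
  | zero => exact Multiset.rel_zero_left.1 ht ▸ .zero
  | cons hab _ ih =>
    obtain ⟨b', t', hb', ht', rfl⟩ := Multiset.rel_cons_left.1 ht
    exact .cons (h _ _ _ hab hb') (ih ht')

lemma multiset_eq_of_forall_rel_norm_sub_lt {s t : Multiset E}
    (h : ∀ ε : ℝ, 0 < ε → Multiset.Rel (fun κ κ' => ‖κ - κ'‖ < ε) s t) : s = t := by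
  classical
  have hsep : ∀ᶠ ε : ℝ in 𝓝[>] 0, ∀ a ∈ s.toFinset, ∀ b ∈ t.toFinset, ‖a - b‖ < ε → a = b := by
    simp only [Filter.eventually_all_finset]
    intro a _ b _
    rcases eq_or_ne a b with hab | hab
    · exact .of_forall fun _ _ => hab
    · filter_upwards [mem_nhdsWithin_of_mem_nhds (Iio_mem_nhds (norm_sub_pos_iff.2 hab))]
        with ε hε hlt
      exact absurd hlt hε.not_gt
  obtain ⟨ε, hε, hpos⟩ := (hsep.and self_mem_nhdsWithin).exists
  rw [← Multiset.rel_eq]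
  exact (h ε hpos).mono fun a ha b hb =>
    hε a (Multiset.mem_toFinset.2 ha) b (Multiset.mem_toFinset.2 hb)

lemma RootwiseTendsto.unique [NeBot F] {s : α → Multiset E} {t t' : Multiset E}
    (ht : RootwiseTendsto s F t) (ht' : RootwiseTendsto s F t') : t = t' := by
  refine multiset_eq_of_forall_rel_norm_sub_lt fun ε hε => ?_
  obtain ⟨x, hx, hx'⟩ := ((ht _ (half_pos hε)).and (ht' _ (half_pos hε))).exists
  refine multiset_rel_trans (fun a b c hab hbc => ?_) (Multiset.rel_flip.2 hx) hx'
  rw [flip, norm_sub_rev] at hab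
  linarith [norm_sub_le_norm_sub_add_norm_sub a b c]

end RootwiseTendsto

section Enumeration

variable {E : Type*} {r : ℕ}

lemma exists_univ_map_eq {s : Multiset E} (hs : s.card = r) :
    ∃ v : Fin r → E, Finset.univ.val.map v = s := by
  obtain ⟨l, rfl⟩ := Quot.exists_rep s
  obtain rfl : l.length = r := hs
  exact ⟨l.get, by simp⟩

lemma exists_tendsto_enumeration [TopologicalSpace E] {K : Set E} (hK : IsCompact K) {α : Type*}
    (g : Ultrafilter α) {s : α → Multiset E}
    (hs : ∀ᶠ x in (g : Filter α), (s x).card = r ∧ ∀ κ ∈ s x, κ ∈ K) :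
    ∃ (v : α → Fin r → E) (y : Fin r → E),
      (fun x => Finset.univ.val.map (v x)) =ᶠ[g] s ∧ Tendsto v g (𝓝 y) := by
  obtain ⟨v₀, -⟩ := exists_univ_map_eq hs.exists.choose_spec.1
  have : Nonempty (Fin r → E) := ⟨v₀⟩
  obtain ⟨v, hv⟩ := Filter.skolem.1 (hs.mono fun x hx => exists_univ_map_eq hx.1)
  have hmem : Set.univ.pi (fun _ => K) ∈ g.map v := by
    rw [Ultrafilter.mem_map]
    filter_upwards [hs, hv] with x hx hvx i _
    exact hx.2 _ (hvx ▸ Multiset.mem_map_of_mem _ (Finset.mem_univ i))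
  obtain ⟨y, -, hy⟩ := (isCompact_univ_pi fun _ => hK).ultrafilter_le_nhds' _ hmem
  exact ⟨v, y, hv, hy⟩

end Enumeration

section LimitOfRoots

variable {α : Type*} {F : Filter α} {r : ℕ}

lemma continuous_coeff_rootPoly_univ_map {ι : Type*} [Fintype ι] (i : ℕ) :
    Continuous fun v : ι → ℂ => (rootPoly (Finset.univ.val.map v)).coeff i := by
  have hgen (v : ι → ℂ) : rootPoly (Finset.univ.val.map v)
      = (rootPoly (Finset.univ.val.map MvPolynomial.X)).map (MvPolynomial.eval v) := by
    simp [rootPoly, Polynomial.map_prod]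
  simp only [hgen, coeff_map]
  exact MvPolynomial.continuous_eval _

lemma exists_rootwiseTendsto_ultrafilter {K : Set ℂ} (hK : IsCompact K) (g : Ultrafilter α)
    {s : α → Multiset ℂ} (hs : ∀ᶠ x in (g : Filter α), (s x).card = r ∧ ∀ κ ∈ s x, κ ∈ K) :
    ∃ t : Multiset ℂ, t.card = r ∧ RootwiseTendsto s g t ∧
      ∀ i, Tendsto (fun x => (rootPoly (s x)).coeff i) g (𝓝 ((rootPoly t).coeff i)) := by
  obtain ⟨v, y, hvs, hvy⟩ := exists_tendsto_enumeration hK g hs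
  refine ⟨Finset.univ.val.map y, by simp, (rootwiseTendsto_univ_map hvy).congr' hvs, fun i => ?_⟩
  refine (((continuous_coeff_rootPoly_univ_map i).tendsto y).comp hvy).congr' ?_
  filter_upwards [hvs] with x hx
  rw [Function.comp_apply, hx]

lemma rootwiseTendsto_of_tendsto_coeff {K : Set ℂ} (hK : IsCompact K) {s : α → Multiset ℂ}
    (hs : ∀ᶠ x in F, (s x).card = r ∧ ∀ κ ∈ s x, κ ∈ K) {t : Multiset ℂ}
    (ht : ∀ i, Tendsto (fun x => (rootPoly (s x)).coeff i) F (𝓝 ((rootPoly t).coeff i))) :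
    RootwiseTendsto s F t := by
  refine fun ε hε => mem_iff_ultrafilter.2 fun g hg => ?_
  obtain ⟨t', -, hroots, hcoeff⟩ := exists_rootwiseTendsto_ultrafilter hK g (hs.filter_mono hg)
  obtain rfl : t' = t := rootPoly_injective <| Polynomial.ext fun i =>
    tendsto_nhds_unique (hcoeff i) ((ht i).mono_left hg)
  exact hroots ε hε

lemma tendsto_remainderMatrix_apply {Q : α → ℂ[X]} {Q₀ : ℂ[X]}
    (hQ : ∀ᶠ x in F, (Q x).Monic ∧ (Q x).natDegree = r) (hQ₀ : Q₀.Monic) (hdeg : Q₀.natDegree = r)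
    (hlim : ∀ i, Tendsto (fun x => (Q x).coeff i) F (𝓝 (Q₀.coeff i))) {n : ℕ} (j : Fin n)
    (i : Fin r) :
    Tendsto (fun x => remainderMatrix n r (Q x) j i) F (𝓝 (remainderMatrix n r Q₀ j i)) := by
  have hgen {Q : ℂ[X]} (hQ : Q.Monic) (hdeg : Q.natDegree = r) : remainderMatrix n r Q j i
      = MvPolynomial.eval (fun i : Fin r => Q.coeff i)
          (remainderMatrix n r (freeMonic ℂ r) j i) := by
    conv_lhs => rw [← map_freeMonic_eval_coeff hQ hdeg,
      remainderMatrix_map _ _ _ (monic_freeMonic _ _), Matrix.map_apply]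
  rw [hgen hQ₀ hdeg]
  refine Tendsto.congr' (hQ.mono fun x hx => (hgen hx.1 hx.2).symm) ?_
  exact (MvPolynomial.continuous_eval _).continuousAt.tendsto.comp
    (tendsto_pi_nhds.2 fun i => hlim i)

lemma coeff_modByMonic_eq_vecMul {R : Type*} [CommRing R] {P : R[X]} {n : ℕ}
    (hP : P.natDegree < n) (Q : R[X]) (i : Fin r) :
    (P %ₘ Q).coeff i = Matrix.vecMul (fun j : Fin n => P.coeff j) (remainderMatrix n r Q) i := by
  conv_lhs => rw [← modByMonicHom_apply, P.as_sum_range' n hP, Finset.sum_range]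
  simp [Matrix.vecMul, dotProduct, remainderMatrix, ← C_mul_X_pow_eq_monomial, ← smul_eq_C_mul]

lemma dvd_iff_vecMul_remainderMatrix_eq_zero {R : Type*} [CommRing R] {P Q : R[X]} {n : ℕ}
    (hP : P.natDegree < n) (hQ : Q.Monic) (hdeg : Q.natDegree = r) :
    Q ∣ P ↔ Matrix.vecMul (fun j : Fin n => P.coeff j) (remainderMatrix n r Q) = 0 := by
  rw [← modByMonic_eq_zero_iff_dvd hQ]
  constructor
  · intro h
    ext i
    rw [← coeff_modByMonic_eq_vecMul hP, h, coeff_zero, Pi.zero_apply]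
  · nontriviality R
    intro h
    ext i
    rw [coeff_zero]
    rcases lt_or_ge i r with hi | hi
    · exact (coeff_modByMonic_eq_vecMul hP Q ⟨i, hi⟩).trans (congrFun h _)
    · refine coeff_eq_zero_of_degree_lt ((degree_modByMonic_lt P hQ).trans_le ?_)
      rw [degree_eq_natDegree hQ.ne_zero, hdeg]
      exact_mod_cast hi

lemma dvd_of_tendsto_coeff [NeBot F] {P Q : α → ℂ[X]} {P₀ Q₀ : ℂ[X]} {n : ℕ}
    (hP : ∀ᶠ x in F, (P x).natDegree < n) (hP₀ : P₀.natDegree < n)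
    (hPlim : ∀ i, Tendsto (fun x => (P x).coeff i) F (𝓝 (P₀.coeff i)))
    (hQ : ∀ᶠ x in F, (Q x).Monic ∧ (Q x).natDegree = r) (hQ₀ : Q₀.Monic) (hdeg : Q₀.natDegree = r)
    (hQlim : ∀ i, Tendsto (fun x => (Q x).coeff i) F (𝓝 (Q₀.coeff i)))
    (hdvd : ∀ᶠ x in F, Q x ∣ P x) : Q₀ ∣ P₀ := by
  rw [dvd_iff_vecMul_remainderMatrix_eq_zero hP₀ hQ₀ hdeg]
  ext i
  refine tendsto_nhds_unique_of_eventuallyEq (f := fun x =>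
    Matrix.vecMul (fun j : Fin n => (P x).coeff j) (remainderMatrix n r (Q x)) i) (l := F)
    ?_ tendsto_const_nhds ?_
  · simp only [Matrix.vecMul, dotProduct]
    exact tendsto_finsetSum _ fun j _ =>
      (hPlim j).mul (tendsto_remainderMatrix_apply hQ hQ₀ hdeg hQlim j i)
  · filter_upwards [hP, hQ, hdvd] with x hPx hQx hx
    rw [(dvd_iff_vecMul_remainderMatrix_eq_zero hPx hQx.1 hQx.2).1 hx]

theorem exists_limit_of_rootPoly_dvd {X ι : Type*} [TopologicalSpace X] {F : Filter X} [NeBot F]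
    {p : ι → Prop} {W : ι → Set X} (hF : F.HasBasis p W) (hpre : ∀ j, p j → IsPreconnected (W j))
    {K : Set ℂ} (hK : IsCompact K) {s : X → Multiset ℂ}
    (hs : ∀ᶠ x in F, (s x).card = r ∧ ∀ κ ∈ s x, κ ∈ K)
    (hcont : ∀ j, p j → ∀ i, ContinuousOn (fun x => (rootPoly (s x)).coeff i) (W j))
    {P : X → ℂ[X]} {P₀ : ℂ[X]} {n : ℕ} (hP : ∀ᶠ x in F, (P x).natDegree < n)
    (hP₀ : P₀.natDegree < n) (hne : P₀ ≠ 0)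
    (hPlim : ∀ i, Tendsto (fun x => (P x).coeff i) F (𝓝 (P₀.coeff i)))
    (hdvd : ∀ᶠ x in F, rootPoly (s x) ∣ P x) :
    ∃ t ≤ P₀.roots, t.card = r ∧ RootwiseTendsto s F t ∧
      ∀ i, Tendsto (fun x => (rootPoly (s x)).coeff i) F (𝓝 ((rootPoly t).coeff i)) := by
  have hfin : {t | t ≤ P₀.roots ∧ t.card = r}.Finite :=
    (Set.finite_Iic P₀.roots).subset fun t ht => ht.1
  obtain ⟨_, ⟨t, ⟨hle, hcard⟩, rfl⟩, hlim⟩ := exists_tendsto_of_tendsto_nhdsSet_finite hF hpre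
    (f := fun x i => (rootPoly (s x)).coeff i) (fun j hj => continuousOn_pi.2 (hcont j hj))
    (hfin.image fun t i => (rootPoly t).coeff i) <| by
      refine tendsto_iff_ultrafilter _ _ _ |>.2 fun g hg => ?_
      obtain ⟨t, hcard, -, hlim⟩ := exists_rootwiseTendsto_ultrafilter hK g (hs.filter_mono hg)
      refine (tendsto_pi_nhds.2 hlim).mono_right (nhds_le_nhdsSet ⟨t, ⟨?_, hcard⟩, rfl⟩)
      exact (rootPoly_dvd_iff_le_roots hne t).1 <| dvd_of_tendsto_coeff (hP.filter_mono hg) hP₀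
        (fun i => (hPlim i).mono_left hg) ((hs.filter_mono hg).mono fun x hx =>
          ⟨monic_rootPoly _, (natDegree_rootPoly _).trans hx.1⟩) (monic_rootPoly t)
        ((natDegree_rootPoly t).trans hcard) hlim (hdvd.filter_mono hg)
  have hlim := tendsto_pi_nhds.1 hlim
  exact ⟨t, hle, hcard, rootwiseTendsto_of_tendsto_coeff hK hs hlim, hlim⟩

end LimitOfRoots

section RootsInBall

open Metric

lemma rootPoly_rootsInBall_dvd (P : ℂ[X]) (c : ℂ) (R : ℝ) : rootPoly (rootsInBall P c R) ∣ P := by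
  by_cases hP : P = 0
  · simp [hP]
  · exact (rootPoly_dvd_iff_le_roots hP _).2 (rootsInBall_le_roots P)

theorem HolomorphicFamily.exists_limit_rootsInBall {P : ℂ → ℂ[X]} {N : ℕ} {U : Set ℂ} {c : ℂ}
    {R : ℝ} (hP : HolomorphicFamily P N U) (hU : IsOpen U) (hconv : Convex ℝ U) (hR : 0 < R)
    (hne : ∀ u ∈ U, ∀ x ∈ sphere c R, (P u).eval x ≠ 0) {u₀ : ℂ} (hu₀ : u₀ ∈ closure U)
    (hdeg : (P u₀).natDegree < N) (hne₀ : P u₀ ≠ 0)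
    (hcont : ∀ i, ContinuousWithinAt (fun u => (P u).coeff i) U u₀) {v : ℂ} (hv : v ∈ U) :
    ∃ t ≤ (P u₀).roots, t.card = (rootsInBall (P v) c R).card ∧
      RootwiseTendsto (fun u => rootsInBall (P u) c R) (𝓝[U] u₀) t ∧
      ∀ i, Tendsto (fun u => (rootPoly (rootsInBall (P u) c R)).coeff i) (𝓝[U] u₀)
        (𝓝 ((rootPoly t).coeff i)) := by
  have := mem_closure_iff_nhdsWithin_neBot.1 hu₀
  have hpre := hconv.isPreconnected
  refine exists_limit_of_rootPoly_dvd (nhdsWithin_basis_ball (x := u₀) (s := U))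
    (fun δ _ => ((convex_ball u₀ δ).inter hconv).isPreconnected) (isCompact_closedBall c R)
    ?_ (fun δ _ i => ?_) ?_ hdeg hne₀ hcont (.of_forall fun u => rootPoly_rootsInBall_dvd _ c R)
  · filter_upwards [self_mem_nhdsWithin] with u hu
    exact ⟨hP.card_rootsInBall_eq hU hpre hR hne hu hv, fun κ hκ =>
      ball_subset_closedBall (mem_ball_of_mem_rootsInBall hκ)⟩
  · exact (hP.differentiableOn_coeff_rootPoly hU hpre hR hne i).continuousOn.mono
      Set.inter_subset_right
  · exact eventually_mem_nhdsWithin.mono hP.natDegree_lt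

end RootsInBall

/-! ### The stable roots -/

section Pencil

open Metric

/-- The polynomial `u A - X ^ r`. For `A = ∑_k a_k X ^ (r + k)` it is the characteristic polynomial
of the scheme divided by `z = u⁻¹`; unlike the latter it extends to the point `u = 0`. -/
def pencil (A : ℂ[X]) (r : ℕ) (u : ℂ) : ℂ[X] := C u * A - X ^ r

variable {A : ℂ[X]} {r : ℕ}

lemma holomorphicFamily_pencil (A : ℂ[X]) (r : ℕ) (U : Set ℂ) :
    HolomorphicFamily (pencil A r) (A.natDegree + r + 1) U where
  differentiableOn_coeff i := by
    simp only [pencil, coeff_sub, coeff_C_mul]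
    fun_prop
  natDegree_lt u _ := by
    have hC := natDegree_C_mul_le u A
    have hX := natDegree_X_pow_le (R := ℂ) r
    have hsub := natDegree_sub_le (C u * A) (X ^ r)
    rw [pencil]
    omega

lemma eval_pencil_ne_zero (hA : ∀ x ∈ sphere (0 : ℂ) 1, ‖A.eval x‖ ≤ 1) :
    ∀ u ∈ ball (0 : ℂ) 1, ∀ x ∈ sphere (0 : ℂ) 1, (pencil A r u).eval x ≠ 0 := by
  intro u hu x hx heval
  rw [pencil, eval_sub, eval_mul, eval_C, eval_pow, eval_X, sub_eq_zero] at heval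
  have hlt : ‖u * A.eval x‖ < 1 := by
    rw [norm_mul]
    exact mul_lt_one_of_nonneg_of_lt_one_left (norm_nonneg u) (by simpa using hu) (hA x hx)
  rw [heval, norm_pow, mem_sphere_zero_iff_norm.1 hx, one_pow] at hlt
  exact lt_irrefl _ hlt

lemma card_rootsInBall_pencil_zero : (rootsInBall (pencil A r 0) 0 1).card = r := by
  simp [rootsInBall, pencil, Multiset.filter_eq_self.2]

lemma card_rootsInBall_pencil (hA : ∀ x ∈ sphere (0 : ℂ) 1, ‖A.eval x‖ ≤ 1) {u : ℂ}
    (hu : u ∈ ball (0 : ℂ) 1) : (rootsInBall (pencil A r u) 0 1).card = r :=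
  ((holomorphicFamily_pencil A r _).card_rootsInBall_eq isOpen_ball
    (convex_ball 0 1).isPreconnected one_pos (eval_pencil_ne_zero hA) hu
    (mem_ball_self one_pos)).trans card_rootsInBall_pencil_zero

end Pencil

section StableRoots

open Metric

/-- The polynomial `∑_{k=-r}^{p} a_k X^{r+k}`, which is `x ^ r` times the symbol at the points
`x = e^{iξ}` of the unit circle. -/
def symbolPoly (r p : ℕ) (a : ℤ → ℂ) : ℂ[X] :=
  ∑ l ∈ Finset.range (r + p + 1), C (a ((l : ℤ) - (r : ℤ))) * X ^ l

variable {r p m : ℕ} {a : ℤ → ℂ} {z : ℂ}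

lemma eval_symbolPoly_exp (r p : ℕ) (a : ℤ → ℂ) (ξ : ℝ) :
    (symbolPoly r p a).eval (Complex.exp (ξ * Complex.I))
      = Complex.exp (ξ * Complex.I) ^ r * symbol r p a ξ := by
  rw [symbolPoly, eval_finsetSum, symbol, Finset.mul_sum]
  refine Finset.sum_nbij' (fun l => (l : ℤ) - r) (fun k => (k + r).toNat) ?_ ?_ ?_ ?_ ?_
  · intro l hl
    simp only [Finset.mem_range, Finset.mem_Icc] at *
    omega
  · intro k hk
    simp only [Finset.mem_range, Finset.mem_Icc] at *
    omega
  · intro l _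
    simp
  · intro k hk
    simp only [Finset.mem_Icc] at *
    omega
  · intro l _
    rw [eval_mul, eval_C, eval_pow, eval_X, mul_left_comm, ← Complex.exp_nat_mul,
      ← Complex.exp_nat_mul, ← Complex.exp_add]
    congr 2
    push_cast
    ring

lemma CauchyStable.norm_eval_symbolPoly_le (hC : CauchyStable r p a) :
    ∀ x ∈ sphere (0 : ℂ) 1, ‖(symbolPoly r p a).eval x‖ ≤ 1 := by
  intro x hx
  rw [mem_sphere_zero_iff_norm] at hx
  have hexp : Complex.exp (x.arg * Complex.I) = x := by
    simpa [hx] using Complex.norm_mul_exp_arg_mul_I x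
  rw [← hexp, eval_symbolPoly_exp, hexp, norm_mul, norm_pow, hx, one_pow, one_mul]
  exact hC _

lemma charPoly_eq_C_mul_pencil (hz : z ≠ 0) :
    charPoly r p a z = C z * pencil (symbolPoly r p a) r z⁻¹ := by
  rw [charPoly, pencil, mul_sub, ← mul_assoc, ← C_mul, mul_inv_cancel₀ hz, C_1, one_mul,
    symbolPoly]

lemma roots_charPoly (hz : z ≠ 0) :
    (charPoly r p a z).roots = (pencil (symbolPoly r p a) r z⁻¹).roots := by
  rw [charPoly_eq_C_mul_pencil hz, roots_C_mul _ hz]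

lemma insideRoots_eq_rootsInBall (hz : z ≠ 0) :
    insideRoots r p a z = rootsInBall (pencil (symbolPoly r p a) r z⁻¹) 0 1 := by
  simp only [insideRoots, rootsInBall, roots_charPoly hz, mem_ball_zero_iff]

lemma eval_zero_charPoly (hr : 1 ≤ r) : (charPoly r p a z).eval 0 = a (-(r : ℤ)) := by
  have hr0 : r ≠ 0 := Nat.one_le_iff_ne_zero.1 hr
  rw [charPoly, Finset.sum_range_succ', eval_sub, eval_add, eval_finsetSum]
  simp [hr0]

lemma charPoly_ne_zero (hr : 1 ≤ r) (har : a (-(r : ℤ)) ≠ 0) : charPoly r p a z ≠ 0 := by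
  intro h
  apply har
  rw [← eval_zero_charPoly (p := p) (a := a) (z := z) hr, h, eval_zero]

lemma zero_notMem_roots_charPoly (hr : 1 ≤ r) (har : a (-(r : ℤ)) ≠ 0) :
    (0 : ℂ) ∉ (charPoly r p a z).roots := fun h =>
  har ((eval_zero_charPoly hr).symm.trans (isRoot_of_mem_roots h))

lemma ne_zero_of_one_le_norm (hz : 1 ≤ ‖z‖) : z ≠ 0 :=
  norm_pos_iff.1 (zero_lt_one.trans_le hz)

lemma inv_mem_ball_zero_one (hz : 1 < ‖z‖) : z⁻¹ ∈ ball (0 : ℂ) 1 := by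
  simpa using inv_lt_one_of_one_lt₀ hz

lemma mem_closure_one_lt_norm (hz : 1 ≤ ‖z‖) : z ∈ closure {w : ℂ | 1 < ‖w‖} := by
  have hcompl : {w : ℂ | 1 < ‖w‖} = (closedBall 0 1)ᶜ := by
    ext w
    simp
  rw [hcompl, closure_compl, interior_closedBall _ one_ne_zero]
  simpa using hz

lemma tendsto_inv_nhdsWithin_one_lt_norm (hz : z ≠ 0) :
    Tendsto (fun w : ℂ => w⁻¹) (𝓝[{w : ℂ | 1 < ‖w‖}] z) (𝓝[ball 0 1] z⁻¹) :=
  tendsto_nhdsWithin_iff.2 ⟨(tendsto_inv₀ hz).mono_left nhdsWithin_le_nhds,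
    eventually_mem_nhdsWithin.mono fun _ hw => inv_mem_ball_zero_one hw⟩

lemma exists_comesFromInside (hr : 1 ≤ r) (har : a (-(r : ℤ)) ≠ 0) (hC : CauchyStable r p a)
    (hz : ‖z‖ = 1) :
    ∃ t ≤ (charPoly r p a z).roots, t.card = r ∧ ComesFromInside r p a z t ∧
      ∀ i, Tendsto (fun w => (rootPoly (insideRoots r p a w)).coeff i)
        (𝓝[{w : ℂ | 1 < ‖w‖}] z) (𝓝 ((rootPoly t).coeff i)) := by
  have hz0 : z ≠ 0 := ne_zero_of_one_le_norm hz.ge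
  have hinv := tendsto_inv_nhdsWithin_one_lt_norm hz0
  have hfam := fun U => holomorphicFamily_pencil (symbolPoly r p a) r U
  have hne₀ : pencil (symbolPoly r p a) r z⁻¹ ≠ 0 :=
    right_ne_zero_of_mul (charPoly_eq_C_mul_pencil hz0 ▸ charPoly_ne_zero hr har)
  obtain ⟨t, hle, hcard, hroots, hcoeff⟩ := (hfam (ball 0 1)).exists_limit_rootsInBall isOpen_ball
    (convex_ball 0 1) one_pos (eval_pencil_ne_zero hC.norm_eval_symbolPoly_le) (u₀ := z⁻¹)
    (by simp [closure_ball, hz]) ((hfam Set.univ).natDegree_lt _ (Set.mem_univ _)) hne₀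
    (fun i => ((hfam Set.univ).differentiableOn_coeff i).continuousOn.continuousWithinAt
      (Set.mem_univ _) |>.mono (Set.subset_univ _)) (mem_ball_self one_pos)
  have heq : (fun w => rootsInBall (pencil (symbolPoly r p a) r w⁻¹) 0 1)
      =ᶠ[𝓝[{w : ℂ | 1 < ‖w‖}] z] insideRoots r p a := by
    filter_upwards [self_mem_nhdsWithin] with w hw
    exact (insideRoots_eq_rootsInBall (ne_zero_of_one_le_norm (le_of_lt hw))).symm
  refine ⟨t, by rwa [roots_charPoly hz0], hcard.trans card_rootsInBall_pencil_zero, ?_,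
    fun i => ((hcoeff i).comp hinv).congr' (heq.fun_comp fun s => (rootPoly s).coeff i)⟩
  exact RootwiseTendsto.congr' (fun ε hε => hinv.eventually (hroots ε hε)) heq

lemma stableRoots_eq_insideRoots (hz : 1 < ‖z‖) : stableRoots r p a z = insideRoots r p a z :=
  if_pos hz

lemma ComesFromInside.unique (hz : 1 ≤ ‖z‖) {s t : Multiset ℂ} (hs : ComesFromInside r p a z s)
    (ht : ComesFromInside r p a z t) : s = t :=
  have := mem_closure_iff_nhdsWithin_neBot.1 (mem_closure_one_lt_norm hz)
  RootwiseTendsto.unique hs ht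

lemma comesFromInside_iff_eq_stableRoots (hr : 1 ≤ r) (har : a (-(r : ℤ)) ≠ 0)
    (hC : CauchyStable r p a) (hz : ‖z‖ = 1) (s : Multiset ℂ) :
    ComesFromInside r p a z s ↔ s = stableRoots r p a z := by
  have hex : ∃ s, ComesFromInside r p a z s :=
    let ⟨t, _, _, ht, _⟩ := exists_comesFromInside hr har hC hz
    ⟨t, ht⟩
  have hstable : ComesFromInside r p a z (stableRoots r p a z) := by
    rw [stableRoots, if_neg hz.not_gt, dif_pos hex]
    exact hex.choose_spec
  exact ⟨fun hs => hs.unique hz.ge hstable, fun hs => hs ▸ hstable⟩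

lemma stableRoots_spec_of_norm_eq_one (hr : 1 ≤ r) (har : a (-(r : ℤ)) ≠ 0)
    (hC : CauchyStable r p a) (hz : ‖z‖ = 1) :
    stableRoots r p a z ≤ (charPoly r p a z).roots ∧ (stableRoots r p a z).card = r ∧
      ∀ i, Tendsto (fun w => (rootPoly (insideRoots r p a w)).coeff i)
        (𝓝[{w : ℂ | 1 < ‖w‖}] z) (𝓝 ((rootPoly (stableRoots r p a z)).coeff i)) := by
  obtain ⟨t, hle, hcard, ht, hcoeff⟩ := exists_comesFromInside hr har hC hz
  rw [← (comesFromInside_iff_eq_stableRoots hr har hC hz t).1 ht]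
  exact ⟨hle, hcard, hcoeff⟩

lemma stableRoots_le_roots (hr : 1 ≤ r) (har : a (-(r : ℤ)) ≠ 0) (hC : CauchyStable r p a)
    (hz : 1 ≤ ‖z‖) : stableRoots r p a z ≤ (charPoly r p a z).roots := by
  rcases hz.eq_or_lt with heq | hlt
  · exact (stableRoots_spec_of_norm_eq_one hr har hC heq.symm).1
  · rw [stableRoots_eq_insideRoots hlt]
    exact Multiset.filter_le _ _

lemma zero_notMem_stableRoots (hr : 1 ≤ r) (har : a (-(r : ℤ)) ≠ 0) (hC : CauchyStable r p a)
    (hz : 1 ≤ ‖z‖) : (0 : ℂ) ∉ stableRoots r p a z := fun h =>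
  zero_notMem_roots_charPoly hr har (Multiset.mem_of_le (stableRoots_le_roots hr har hC hz) h)

lemma card_stableRoots (hr : 1 ≤ r) (har : a (-(r : ℤ)) ≠ 0) (hC : CauchyStable r p a)
    (hz : 1 ≤ ‖z‖) : (stableRoots r p a z).card = r := by
  rcases hz.eq_or_lt with heq | hlt
  · exact (stableRoots_spec_of_norm_eq_one hr har hC heq.symm).2.1
  · rw [stableRoots_eq_insideRoots hlt, insideRoots_eq_rootsInBall (ne_zero_of_one_le_norm hz)]
    exact card_rootsInBall_pencil hC.norm_eval_symbolPoly_le (inv_mem_ball_zero_one hlt)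

lemma differentiableOn_coeff_rootPoly_stableRoots (hC : CauchyStable r p a) (i : ℕ) :
    DifferentiableOn ℂ (fun z => (rootPoly (stableRoots r p a z)).coeff i)
      {z : ℂ | 1 < ‖z‖} := by
  have hinv : DifferentiableOn ℂ (fun z : ℂ => z⁻¹) {z : ℂ | 1 < ‖z‖} := fun z hz =>
    (differentiableAt_inv (ne_zero_of_one_le_norm (le_of_lt hz))).differentiableWithinAt
  have hcoeff := (holomorphicFamily_pencil (symbolPoly r p a) r _).differentiableOn_coeff_rootPoly
    isOpen_ball (convex_ball 0 1).isPreconnected one_pos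
    (eval_pencil_ne_zero hC.norm_eval_symbolPoly_le) i
  refine (hcoeff.comp hinv fun z hz => inv_mem_ball_zero_one hz).congr fun z hz => ?_
  rw [stableRoots_eq_insideRoots hz,
    insideRoots_eq_rootsInBall (ne_zero_of_one_le_norm (le_of_lt hz)), Function.comp_apply]

lemma continuousOn_coeff_rootPoly_stableRoots (hr : 1 ≤ r) (har : a (-(r : ℤ)) ≠ 0)
    (hC : CauchyStable r p a) (i : ℕ) :
    ContinuousOn (fun z => (rootPoly (stableRoots r p a z)).coeff i) {z : ℂ | 1 ≤ ‖z‖} := by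
  have htendsto : ∀ z : ℂ, 1 ≤ ‖z‖ →
      Tendsto (fun w => (rootPoly (stableRoots r p a w)).coeff i) (𝓝[{w : ℂ | 1 < ‖w‖}] z)
        (𝓝 ((rootPoly (stableRoots r p a z)).coeff i)) := by
    intro z hz
    rcases hz.eq_or_lt with heq | hlt
    · refine ((stableRoots_spec_of_norm_eq_one hr har hC heq.symm).2.2 i).congr' ?_
      filter_upwards [self_mem_nhdsWithin] with w hw
      rw [stableRoots_eq_insideRoots hw]
    · exact (differentiableOn_coeff_rootPoly_stableRoots hC i).continuousOn z hlt
  have hclosure : {z : ℂ | 1 ≤ ‖z‖} ⊆ closure {z : ℂ | 1 < ‖z‖} :=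
    fun z => mem_closure_one_lt_norm
  exact (continuousOn_extendFrom hclosure fun z hz => ⟨_, htendsto z hz⟩).congr fun z hz =>
    (extendFrom_eq (hclosure hz) (htendsto z hz)).symm

end StableRoots

section IntrinsicDet

variable {r p m : ℕ} {a : ℤ → ℂ} {z : ℂ}

lemma klDet_div_det_kMat (b : Matrix (Fin r) (Fin m) ℂ) (hs : 0 ∉ stableRoots r p a z)
    (e : Fin r ≃ (stableRoots r p a z).ToType) :
    klDet r p m a b z e / (kMat r p a z e r).det = reducedDet (boundaryMatrix r p m a b) z
      fun i => (rootPoly (stableRoots r p a z)).coeff i := by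
  rw [reducedDet_coeff _ _ (monic_rootPoly _)
    ((natDegree_rootPoly _).trans (card_eq_of_equiv_toType e))]
  exact det_sub_kMatrix_div_det hs e _ z

lemma intrinsicDet_eq_reducedDet (b : Matrix (Fin r) (Fin m) ℂ) (hs : 0 ∉ stableRoots r p a z)
    (hcard : (stableRoots r p a z).card = r) :
    intrinsicDet r p m a b z = reducedDet (boundaryMatrix r p m a b) z
      fun i => (rootPoly (stableRoots r p a z)).coeff i := by
  have he : Nonempty (Fin r ≃ (stableRoots r p a z).ToType) :=
    ⟨(Fintype.equivFinOfCardEq (by rw [Multiset.card_coe, hcard])).symm⟩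
  rw [intrinsicDet, dif_pos he, klDet_div_det_kMat b hs]

lemma differentiableOn_intrinsicDet (hr : 1 ≤ r) (har : a (-(r : ℤ)) ≠ 0)
    (hC : CauchyStable r p a) (b : Matrix (Fin r) (Fin m) ℂ) :
    DifferentiableOn ℂ (intrinsicDet r p m a b) {z : ℂ | 1 < ‖z‖} := by
  have hcoeffs : DifferentiableOn ℂ
      (fun z => (z, fun i : Fin r => (rootPoly (stableRoots r p a z)).coeff i))
      {z : ℂ | 1 < ‖z‖} :=
    differentiableOn_id.prodMk (differentiableOn_pi.2 fun i =>
      differentiableOn_coeff_rootPoly_stableRoots hC i)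
  exact ((differentiable_reducedDet (boundaryMatrix r p m a b)).comp_differentiableOn hcoeffs).congr
    fun z hz => intrinsicDet_eq_reducedDet b (zero_notMem_stableRoots hr har hC (le_of_lt hz))
      (card_stableRoots hr har hC (le_of_lt hz))

lemma continuousOn_intrinsicDet (hr : 1 ≤ r) (har : a (-(r : ℤ)) ≠ 0) (hC : CauchyStable r p a)
    (b : Matrix (Fin r) (Fin m) ℂ) :
    ContinuousOn (intrinsicDet r p m a b) {z : ℂ | 1 ≤ ‖z‖} := by
  have hcoeffs : ContinuousOn
      (fun z => (z, fun i : Fin r => (rootPoly (stableRoots r p a z)).coeff i))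
      {z : ℂ | 1 ≤ ‖z‖} :=
    continuousOn_id.prodMk (continuousOn_pi.2 fun i =>
      continuousOn_coeff_rootPoly_stableRoots hr har hC i)
  exact ((differentiable_reducedDet (boundaryMatrix r p m a b)).continuous.comp_continuousOn
    hcoeffs).congr fun z hz => intrinsicDet_eq_reducedDet b
      (zero_notMem_stableRoots hr har hC hz) (card_stableRoots hr har hC hz)

end IntrinsicDet

end

end KreissLopatinskii

open KreissLopatinskii in
theorem theorem3p1_general (r p m : ℕ) (hr : 1 ≤ r) (a : ℤ → ℂ) (har : a (-(r : ℤ)) ≠ 0)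
    (b : Matrix (Fin r) (Fin m) ℂ) (hC : CauchyStable r p a) :
    (∀ z : ℂ, ‖z‖ = 1 → ∀ s : Multiset ℂ,
      ComesFromInside r p a z s ↔ s = stableRoots r p a z) ∧
    (∀ z : ℂ, 1 ≤ ‖z‖ → (stableRoots r p a z).card = r) ∧
    (∀ z : ℂ, 1 ≤ ‖z‖ → ∀ e : Fin r ≃ (stableRoots r p a z).ToType,
      (kMat r p a z e r).det ≠ 0 ∧
      intrinsicDet r p m a b z = klDet r p m a b z e / (kMat r p a z e r).det) ∧
    DifferentiableOn ℂ (intrinsicDet r p m a b) {z : ℂ | 1 < ‖z‖} ∧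
    ContinuousOn (intrinsicDet r p m a b) {z : ℂ | 1 ≤ ‖z‖} := by
  refine ⟨fun z hz => comesFromInside_iff_eq_stableRoots hr har hC hz,
    fun z hz => card_stableRoots hr har hC hz, fun z hz e => ?_,
    differentiableOn_intrinsicDet hr har hC b, continuousOn_intrinsicDet hr har hC b⟩
  have hs := zero_notMem_stableRoots hr har hC hz
  refine ⟨det_kMatrix_ne_zero hs e, ?_⟩
  rw [intrinsicDet_eq_reducedDet b hs (card_stableRoots hr har hC hz), klDet_div_det_kMat b hs e]

/-- The first three conjuncts say that `Δ` is well defined on `{|z| ≥ 1}`; the last two are its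
holomorphy on `{|z| > 1}` and its continuity on `{|z| ≥ 1}`. -/
theorem theorem3p1 (r p m : ℕ) (hr : 1 ≤ r) (hp : 1 ≤ p) (hm : p + r ≤ m)
    (a : ℤ → ℂ) (hap : a (p : ℤ) ≠ 0) (har : a (-(r : ℤ)) ≠ 0)
    (b : Matrix (Fin r) (Fin m) ℂ) (hC : KreissLopatinskii.CauchyStable r p a) :
    (∀ z : ℂ, ‖z‖ = 1 → ∀ s : Multiset ℂ,
      KreissLopatinskii.ComesFromInside r p a z s ↔ s = KreissLopatinskii.stableRoots r p a z) ∧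
    (∀ z : ℂ, 1 ≤ ‖z‖ → Multiset.card (KreissLopatinskii.stableRoots r p a z) = r) ∧
    (∀ z : ℂ, 1 ≤ ‖z‖ → ∀ e : Fin r ≃ (KreissLopatinskii.stableRoots r p a z).ToType,
      (KreissLopatinskii.kMat r p a z e r).det ≠ 0 ∧
      KreissLopatinskii.intrinsicDet r p m a b z =
        KreissLopatinskii.klDet r p m a b z e / (KreissLopatinskii.kMat r p a z e r).det) ∧
    DifferentiableOn ℂ (KreissLopatinskii.intrinsicDet r p m a b) {z : ℂ | 1 < ‖z‖} ∧
    ContinuousOn (KreissLopatinskii.intrinsicDet r p m a b) {z : ℂ | 1 ≤ ‖z‖} :=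
  theorem3p1_general r p m hr a har b hC
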